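/- Let $\pi$ be a set of primes, let $\pi'$ be the set of all primes not in $\pi$, and let $G$ be a finite $\pi$-soluble group, i.e. a finite group each of whose chief factors is either a $\pi'$-group or an elementary abelian $p$-group for some $p\in\pi$. A finite group is called $\pi$-closed if it has a normal Hall $\pi$-subgroup; the $\pi$-closed radical $G_{\mathfrak F}$ of $G$ is the join of all normal $\pi$-closed subgroups of $G$; $O_\pi(G)$ is the join of all normal $\pi$-subgroups of $G$. A $\pi$-closed injector of $G$ is a subgroup $V\le G$ such that, for every subnormal subgroup $K$ of $G$, $V\cap K$ is maximal (under inclusion) among the $\pi$-closed subgroups of $K$. Then, for every subgroup $V$ of $G$: (1) $V$ is a $\pi$-closed injector of $G$ if and only if $V=G_{\pi'}O_\pi(G)$ for some Hall $\pi'$-subgroup $G_{\pi'}$ of $G$; (2) $V$ is a $\pi$-closed injector of $G$ if and only if $V$ is a maximal $\pi$-closed subgroup of $G$ (that is, maximal under inclusion among all $\pi$-closed subgroups of $G$) and $G_{\mathfrak F}\le V$. -/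

import Mathlib

namespace PiClosedInjectors

/-- A `π`-group: every prime divisor of its order lies in `π` (used for finite groups).
The set `π'` of the remaining primes is the complement `πᶜ`. -/
def IsPiGroup (π : Set Nat.Primes) (G : Type*) [Group G] : Prop :=
  ∀ p : Nat.Primes, (p : ℕ) ∣ Nat.card G → p ∈ π

/-- A Hall `π`-subgroup: a `π`-subgroup whose index is divisible by no prime of `π`. -/
def IsHall {G : Type*} [Group G] (π : Set Nat.Primes) (H : Subgroup G) : Prop :=
  IsPiGroup π H ∧ ∀ p : Nat.Primes, (p : ℕ) ∣ H.index → p ∉ π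

/-- A `π`-closed group: it has a normal Hall `π`-subgroup. -/
def IsPiClosed (π : Set Nat.Primes) (G : Type*) [Group G] : Prop :=
  ∃ N : Subgroup G, N.Normal ∧ IsHall π N

/-- `H / K` is a chief factor of `G`, for normal subgroups `H` and `K` of `G`: `K < H` and no normal
subgroup of `G` lies strictly between `K` and `H`. -/
def IsChiefFactor {G : Type*} [Group G] (H K : Subgroup G) : Prop :=
  K < H ∧ ∀ N : Subgroup G, N.Normal → K ≤ N → N ≤ H → N = K ∨ N = H

/-- An elementary abelian `p`-group. -/
def IsElementaryAbelian (p : ℕ) (G : Type*) [Group G] : Prop :=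
  (∀ x y : G, x * y = y * x) ∧ ∀ x : G, x ^ p = 1

/-- A `π`-soluble group: every chief factor is a `π'`-group or an elementary abelian `p`-group
for some prime `p` in `π`. -/
def IsPiSoluble (π : Set Nat.Primes) (G : Type*) [Group G] : Prop :=
  ∀ (H K : Subgroup G) [H.Normal] [K.Normal], IsChiefFactor H K →
    IsPiGroup πᶜ (H ⧸ K.subgroupOf H) ∨
      ∃ p ∈ π, IsElementaryAbelian (p : ℕ) (H ⧸ K.subgroupOf H)

/-- `O_π(G)`, the join of all normal `π`-subgroups of `G`. -/
def piCore (π : Set Nat.Primes) (G : Type*) [Group G] : Subgroup G :=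
  sSup {N : Subgroup G | N.Normal ∧ IsPiGroup π N}

/-- The set of all `π`-closed subgroups of `G`. -/
def piClosedSubgroups (π : Set Nat.Primes) (G : Type*) [Group G] : Set (Subgroup G) :=
  {H : Subgroup G | IsPiClosed π H}

/-- The radical of `G` for a set `𝓕` of subgroups: the join of all normal subgroups
of `G` that belong to `𝓕`. -/
def radical {G : Type*} [Group G] (𝓕 : Set (Subgroup G)) : Subgroup G :=
  sSup {N : Subgroup G | N.Normal ∧ N ∈ 𝓕}

/-- `V` is an `𝓕`-maximal subgroup of the subgroup `K`: it is maximal, under inclusion,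
among the subgroups of `K` that belong to `𝓕`. -/
def IsMaximalIn {G : Type*} [Group G] (𝓕 : Set (Subgroup G)) (K V : Subgroup G) : Prop :=
  Maximal (fun U : Subgroup G => U ∈ 𝓕 ∧ U ≤ K) V

/-- `V` is an `𝓕`-injector of `G`: `V ∩ K` is an `𝓕`-maximal subgroup of `K` for every
subnormal subgroup `K` of `G`. -/
def IsInjector {G : Type*} [Group G] (𝓕 : Set (Subgroup G)) (V : Subgroup G) : Prop :=
  ∀ K : Subgroup G, K.IsSubnormal → IsMaximalIn 𝓕 K (V ⊓ K)

end PiClosedInjectors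

/-! Both characterisations pass through one condition, `IsHallOverCore`: `V` contains `O_π(G)` and
`V / O_π(G)` is a Hall `π'`-subgroup of `G / O_π(G)`. By Schur–Zassenhaus this says `V = G_{π'}
O_π(G)`.

The radical is `O_{π,π'}(G)`. Modulo `O_π(G)`, the Hall–Higman argument gives `C(O_{π'}) ≤ O_{π'}`,
so a `π`-subgroup normalized by `O_{π'}` is trivial. Hence a `π`-closed `W` containing the radical
is a `π'`-group modulo `O_π(G)`. Such a `W` lies in some Hall `π'`-subgroup over the core
(`exists_hall_ge`), so it satisfies the condition once it is maximal.

Conversely, the condition forces `V` to contain the radical and to be maximal `π`-closed. It is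
inherited by normal, hence subnormal, subgroups, so `V` is an injector. -/

namespace PiClosedInjectors

open Subgroup
open scoped commutatorElement Pointwise

/-- Every prime divisor of `n` lies in `π`. -/
def IsPiNumber (π : Set Nat.Primes) (n : ℕ) : Prop :=
  ∀ p : Nat.Primes, (p : ℕ) ∣ n → p ∈ π

/-! ### Arithmetic of `π`-numbers and indices -/

section Numbers

variable {π : Set Nat.Primes} {m n : ℕ}

theorem IsPiNumber.of_dvd (hn : IsPiNumber π n) (h : m ∣ n) : IsPiNumber π m :=
  fun p hp => hn p (hp.trans h)

theorem IsPiNumber.mul (hm : IsPiNumber π m) (hn : IsPiNumber π n) : IsPiNumber π (m * n) :=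
  fun p hp => (p.2.dvd_mul.1 hp).elim (hm p) (hn p)

theorem isPiNumber_one : IsPiNumber π 1 :=
  fun p hp => absurd (Nat.dvd_one.1 hp) p.2.one_lt.ne'

theorem IsPiNumber.coprime (hm : IsPiNumber π m) (hn : IsPiNumber πᶜ n) : Nat.Coprime m n :=
  Nat.coprime_of_dvd fun p hp h₁ h₂ => hn ⟨p, hp⟩ h₂ (hm ⟨p, hp⟩ h₁)

theorem IsPiNumber.eq_one (hm : IsPiNumber π n) (hn : IsPiNumber πᶜ n) : n = 1 :=
  (Nat.coprime_self n).1 (hm.coprime hn)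

end Numbers

section Index

variable {G : Type*} [Group G]

theorem relIndex_dvd_of_le_right (N : Subgroup G) [N.Normal] {H K : Subgroup G} (h : H ≤ K) :
    N.relIndex H ∣ N.relIndex K := by
  rw [← relIndex_subgroupOf (H := N) h]
  exact relIndex_dvd_index_of_normal _ _

theorem card_mul_relIndex {H K : Subgroup G} (h : H ≤ K) :
    Nat.card H * H.relIndex K = Nat.card K := by
  rw [← relIndex_bot_left, ← relIndex_bot_left]
  exact relIndex_mul_relIndex _ _ _ bot_le h

/-- By order counting, both sides equal `|N| / |H ∩ N|`; `H` need not be normal. -/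
theorem relIndex_sup_of_normal_right [Finite G] (H N : Subgroup G) [N.Normal] :
    H.relIndex (H ⊔ N) = H.relIndex N := by
  have h₁ := card_mul_relIndex (le_sup_left : H ≤ H ⊔ N)
  have h₂ := card_mul_relIndex (le_sup_right : N ≤ H ⊔ N)
  have h₃ := card_mul_relIndex (inf_le_left : H ⊓ N ≤ H)
  have h₄ := card_mul_relIndex (inf_le_right : H ⊓ N ≤ N)
  rw [inf_relIndex_left] at h₃
  rw [inf_relIndex_right] at h₄
  rw [relIndex_sup_right] at h₂
  have hpos : 0 < Nat.card H := Nat.card_pos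
  apply Nat.eq_of_mul_eq_mul_left hpos
  rw [h₁, ← h₂, ← h₃, ← h₄]
  ring

theorem relIndex_dvd_index_of_normal_right [Finite G] (H N : Subgroup G) [N.Normal] :
    H.relIndex N ∣ H.index := by
  rw [← relIndex_sup_of_normal_right]
  exact relIndex_dvd_index_of_le le_sup_left

end Index

/-! ### Normal steps and their inheritance -/

/-- Above every proper normal subgroup `K` of `G` there is a normal subgroup `L` such that `L / K`
is a `π'`-group or an abelian `π`-group. -/
def HasPiSteps (π : Set Nat.Primes) (G : Type*) [Group G] : Prop :=
  ∀ K : Subgroup G, K.Normal → K ≠ ⊤ → ∃ L : Subgroup G, L.Normal ∧ K < L ∧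
    (IsPiNumber πᶜ (K.relIndex L) ∨
      IsPiNumber π (K.relIndex L) ∧ ∀ x ∈ L, ∀ y ∈ L, ⁅x, y⁆ ∈ K)

theorem IsPiSoluble.hasPiSteps {π : Set Nat.Primes} {G : Type*} [Group G] [Finite G]
    (hG : IsPiSoluble π G) : HasPiSteps π G := by
  intro K hK hne
  obtain ⟨L, hL⟩ := exists_minimal_of_wellFoundedLT (fun L : Subgroup G => L.Normal ∧ K < L)
    ⟨⊤, inferInstance, lt_top_iff_ne_top.2 hne⟩
  have hLn := hL.prop.1
  refine ⟨L, hLn, hL.prop.2, ?_⟩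
  have hchief : IsChiefFactor L K := by
    refine ⟨hL.prop.2, fun N hN h₁ h₂ => ?_⟩
    rcases eq_or_lt_of_le h₁ with h | h
    · exact Or.inl h.symm
    · exact Or.inr (le_antisymm h₂ (hL.le_of_le ⟨hN, h⟩ h₂))
  rcases hG L K hchief with h | ⟨p, hp, hcomm, hpow⟩
  · exact Or.inl h
  · refine Or.inr ⟨fun q hq => ?_, fun x hx y hy => ?_⟩
    · have : Fact (q : ℕ).Prime := ⟨q.2⟩
      obtain ⟨x, hx⟩ := exists_prime_orderOf_dvd_card' (G := L ⧸ K.subgroupOf L) (q : ℕ) hq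
      have h := orderOf_dvd_of_pow_eq_one (hpow x)
      rw [hx, Nat.prime_dvd_prime_iff_eq q.2 p.2] at h
      rwa [Subtype.ext h]
    · have h := hcomm (⟨x, hx⟩ : L) (⟨y, hy⟩ : L)
      rw [← commutatorElement_eq_one_iff_mul_comm] at h
      exact (QuotientGroup.eq_one_iff (N := K.subgroupOf L) ⁅(⟨x, hx⟩ : L), ⟨y, hy⟩⁆).1 h

/-- With `M` a maximal normal subgroup of `G` whose trace on `B` lies in `A`, and `M'` a step above
`M`, the product of `A` with the trace of `M'` on `B` is a step above `A`. Taking `B = ⊤` gives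
inheritance by subgroups; taking `f = id` gives steps below a normal subgroup. -/
theorem HasPiSteps.exists_le {π : Set Nat.Primes} {G X : Type*} [Group G] [Group X] [Finite G]
    (hG : HasPiSteps π G) (f : X →* G) (hf : Function.Injective f) (A B : Subgroup X)
    [A.Normal] [B.Normal] (hAB : A < B) :
    ∃ L : Subgroup X, L.Normal ∧ A < L ∧ L ≤ B ∧ (IsPiNumber πᶜ (A.relIndex L) ∨
      IsPiNumber π (A.relIndex L) ∧ ∀ x ∈ L, ∀ y ∈ L, ⁅x, y⁆ ∈ A) := by
  obtain ⟨M, hM⟩ := exists_maximal_of_wellFoundedGT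
    (fun M : Subgroup G => M.Normal ∧ M.comap f ⊓ B ≤ A)
    ⟨⊥, inferInstance, by
      rw [MonoidHom.comap_bot, f.ker_eq_bot hf, bot_inf_eq]; exact bot_le⟩
  have hMn := hM.prop.1
  have hMtop : M ≠ ⊤ := by
    rintro rfl
    have := hM.prop.2
    rw [comap_top, top_inf_eq] at this
    exact hAB.not_ge this
  obtain ⟨M', hM'n, hlt, hstep⟩ := hG M hMn hMtop
  have hnot : ¬ M'.comap f ⊓ B ≤ A := fun h => hlt.not_ge (hM.le_of_ge ⟨hM'n, h⟩ hlt.le)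
  have hdvd : A.relIndex (A ⊔ (M'.comap f ⊓ B)) ∣ M.relIndex M' := by
    rw [relIndex_sup_left]
    calc A.relIndex (M'.comap f ⊓ B) ∣ (M.comap f ⊓ B).relIndex (M'.comap f ⊓ B) :=
          relIndex_dvd_of_le_left _ hM.prop.2
      _ = (M.comap f).relIndex (M'.comap f ⊓ B) := by
          rw [← inf_relIndex_right, ← inf_relIndex_right (M.comap f)]
          congr 1
          rw [inf_assoc, inf_eq_right.2 (inf_le_right : M'.comap f ⊓ B ≤ B)]
      _ ∣ (M.comap f).relIndex (M'.comap f) := relIndex_dvd_of_le_right _ inf_le_left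
      _ = M.relIndex ((M'.comap f).map f) := relIndex_comap _ _ _
      _ ∣ M.relIndex M' := relIndex_dvd_of_le_right _ (map_comap_le f M')
  refine ⟨A ⊔ (M'.comap f ⊓ B), inferInstance, ?_, sup_le hAB.le inf_le_right, ?_⟩
  · exact lt_of_le_of_ne le_sup_left fun h => hnot (h ▸ le_sup_right)
  · refine hstep.imp (fun h => h.of_dvd hdvd) fun ⟨h, hc⟩ => ⟨h.of_dvd hdvd, fun x hx y hy => ?_⟩
    obtain ⟨a, ha, b, hb, rfl⟩ := mem_sup_of_normal_left.1 hx
    obtain ⟨a', ha', b', hb', rfl⟩ := mem_sup_of_normal_left.1 hy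
    have h₁ : ⁅b, b'⁆ ∈ A := hM.prop.2 ⟨by
      change f ⁅b, b'⁆ ∈ M
      rw [map_commutatorElement]
      exact hc _ hb.1 _ hb'.1,
      commutator_le_left B B (commutator_mem_commutator hb.2 hb'.2)⟩
    rw [← QuotientGroup.eq_one_iff] at ha ha' h₁ ⊢
    rw [← QuotientGroup.mk'_apply, map_commutatorElement] at h₁ ⊢
    simpa [ha, ha'] using h₁

theorem HasPiSteps.subgroup {π : Set Nat.Primes} {G : Type*} [Group G] [Finite G]
    (hG : HasPiSteps π G) (H : Subgroup G) : HasPiSteps π H := by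
  intro K hK hne
  obtain ⟨L, h₁, h₂, -, h₃⟩ :=
    hG.exists_le H.subtype H.subtype_injective K ⊤ (lt_top_iff_ne_top.2 hne)
  exact ⟨L, h₁, h₂, h₃⟩

theorem HasPiSteps.quotient {π : Set Nat.Primes} {G : Type*} [Group G]
    (hG : HasPiSteps π G) (N : Subgroup G) [N.Normal] : HasPiSteps π (G ⧸ N) := by
  intro K hK hne
  have hs := QuotientGroup.mk'_surjective N
  obtain ⟨L, hL, hlt, h⟩ := hG (K.comap (QuotientGroup.mk' N)) inferInstance (fun h => hne (by
    rw [← comap_top (QuotientGroup.mk' N)] at h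
    exact comap_injective hs h))
  have hle : (QuotientGroup.mk' N).ker ≤ L := (MonoidHom.ker_le_comap _ _).trans hlt.le
  have hrel : (K.comap (QuotientGroup.mk' N)).relIndex L =
    K.relIndex (L.map (QuotientGroup.mk' N)) := relIndex_comap _ _ _
  refine ⟨L.map (QuotientGroup.mk' N), hL.map _ hs, ?_, ?_⟩
  · rw [← comap_lt_comap_of_surjective hs, comap_map_eq_self hle]
    exact hlt
  · rw [← hrel]
    refine h.imp id fun ⟨h₁, h₂⟩ => ⟨h₁, ?_⟩
    rintro _ ⟨x, hx, rfl⟩ _ ⟨y, hy, rfl⟩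
    rw [← map_commutatorElement]
    exact h₂ x hx y hy

/-! ### Complements containing a prescribed subgroup -/

section Complements

variable {G : Type*} [Group G]

/-- A left transversal of a normal subgroup `H` that is stable under right multiplication by a
subgroup `Q` which meets `H` trivially. -/
theorem exists_leftTransversal_mul_right_stable (H Q : Subgroup G) [H.Normal] (hHQ : H ⊓ Q = ⊥) :
    ∃ T : H.LeftTransversal, ∀ q ∈ Q, ∀ t ∈ (T : Set G), t * q ∈ (T : Set G) := by
  obtain ⟨S, hS, -⟩ := (Q ⊔ H).exists_isComplement_left 1
  -- With `S` a left transversal of `QH`, the set `SQ` is the required transversal of `H`.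
  rw [isComplement_iff_existsUnique_inv_mul_mem] at hS
  refine ⟨⟨{g | ∃ s ∈ S, ∃ q ∈ Q, s * q = g}, ?_⟩, ?_⟩
  · rw [isComplement_iff_existsUnique_inv_mul_mem]
    intro g
    obtain ⟨s, hs, huniq⟩ := hS g
    obtain ⟨q, hq, h, hh, hqh⟩ := mem_sup_of_normal_right.1 hs
    refine ⟨⟨s * q, s, s.2, q, hq, rfl⟩, ?_, ?_⟩
    · have : ((s : G) * q)⁻¹ * g = h := by rw [mul_inv_rev, mul_assoc, ← hqh]; group
      change ((s : G) * q)⁻¹ * g ∈ H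
      rwa [this]
    · rintro ⟨_, s', hs', q', hq', rfl⟩ hmem
      have hmem : (s' * q')⁻¹ * g ∈ H := hmem
      have hss : s' = s := congrArg Subtype.val (huniq ⟨s', hs'⟩ (by
        have : s'⁻¹ * g = q' * ((s' * q')⁻¹ * g) := by group
        change s'⁻¹ * g ∈ Q ⊔ H
        rw [this]
        exact mul_mem (mem_sup_left hq') (mem_sup_right hmem)))
      subst hss
      have hqq : q'⁻¹ * q ∈ H ⊓ Q := by
        refine mem_inf.2 ⟨?_, mul_mem (inv_mem hq') hq⟩
        have hg : g = s * (q * h) := by rw [hqh]; group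
        have : q'⁻¹ * q = (s * q')⁻¹ * g * h⁻¹ := by rw [hg]; group
        rw [this]
        exact mul_mem hmem (inv_mem hh)
      rw [hHQ, mem_bot, inv_mul_eq_one] at hqq
      subst hqq
      rfl
  · rintro q hq _ ⟨s, hs, q', hq', rfl⟩
    exact ⟨s, hs, q' * q, mul_mem hq' hq, by rw [mul_assoc]⟩

/-- A normal abelian Hall subgroup has a complement containing a given subgroup of coprime order. -/
theorem exists_isComplement'_ge [Finite G] (H Q : Subgroup G) [H.Normal] [IsMulCommutative H]
    (hH : Nat.Coprime (Nat.card H) H.index) (hQ : Nat.Coprime (Nat.card H) (Nat.card Q)) :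
    ∃ C : Subgroup G, Q ≤ C ∧ IsComplement' H C := by
  obtain ⟨T, hT⟩ := exists_leftTransversal_mul_right_stable H Q
    (disjoint_of_coprime_natCard hQ).eq_bot
  let α : H.QuotientDiff := Quotient.mk'' T
  refine ⟨MulAction.stabilizer G α, fun q hq => ?_, isComplement'_stabilizer_of_coprime hH⟩
  rw [MulAction.mem_stabilizer_iff]
  -- The complement is the stabilizer of a class of transversals, on which `q` acts by right
  -- translation by `q⁻¹`; stability of `T` under `Q` puts `Q` inside it.
  change (Quotient.mk'' (MulOpposite.op q⁻¹ • T) : H.QuotientDiff) = Quotient.mk'' T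
  congr 1
  apply Subtype.ext
  change MulOpposite.op q⁻¹ • (T : Set G) = T
  ext x
  rw [Set.mem_smul_set_iff_inv_smul_mem]
  change x * q⁻¹⁻¹ ∈ (T : Set G) ↔ _
  rw [inv_inv]
  refine ⟨fun h => ?_, hT q hq x⟩
  simpa using hT q⁻¹ (inv_mem hq) _ h

theorem exists_relative_complement_ge [Finite G] (A Y Q : Subgroup G) [A.Normal] (hAY : A ≤ Y)
    (hQY : Q ≤ Y) (hcomm : ∀ x ∈ A, ∀ y ∈ A, x * y = y * x)
    (hA : Nat.Coprime (Nat.card A) (A.relIndex Y)) (hQ : Nat.Coprime (Nat.card A) (Nat.card Q)) :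
    ∃ C : Subgroup G, Q ≤ C ∧ C ≤ Y ∧ Nat.card C = A.relIndex Y ∧ C.relIndex Y = Nat.card A := by
  have : IsMulCommutative (A.subgroupOf Y) :=
    ⟨⟨fun x y => Subtype.ext (Subtype.ext (hcomm _ x.2 _ y.2))⟩⟩
  have hcA : Nat.card (A.subgroupOf Y) = Nat.card A :=
    Nat.card_congr (subgroupOfEquivOfLe hAY).toEquiv
  have hcQ : Nat.card (Q.subgroupOf Y) = Nat.card Q :=
    Nat.card_congr (subgroupOfEquivOfLe hQY).toEquiv
  obtain ⟨C, hQC, hC⟩ := exists_isComplement'_ge (A.subgroupOf Y) (Q.subgroupOf Y)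
    (by rwa [hcA]) (by rwa [hcA, hcQ])
  refine ⟨C.map Y.subtype, ?_, map_subtype_le C, ?_, ?_⟩
  · rw [← map_subgroupOf_eq_of_le hQY]
    exact map_mono hQC
  · rw [card_map_of_injective Y.subtype_injective]
    exact hC.symm.index_eq_card.symm
  · rw [relIndex, subgroupOf, comap_map_eq_self_of_injective Y.subtype_injective,
      hC.index_eq_card, hcA]

end Complements

/-! ### Hall `π'`-subgroups over a normal subgroup -/

/-- Over a normal subgroup `N`, every subgroup `H` with `H / N` a `π'`-group lies in some `V` with
`V / N` a Hall `π'`-subgroup of `G / N`. -/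
theorem HasPiSteps.exists_hall_ge {π : Set Nat.Primes} {G : Type*} [Group G] [Finite G]
    (hG : HasPiSteps π G) (N : Subgroup G) (hN : N.Normal) (H : Subgroup G) (hNH : N ≤ H)
    (hH : IsPiNumber πᶜ (N.relIndex H)) :
    ∃ V : Subgroup G, H ≤ V ∧ IsPiNumber πᶜ (N.relIndex V) ∧ IsPiNumber π V.index := by
  induction N using WellFoundedGT.induction generalizing H with
  | ind N ih =>
  by_cases htop : N = ⊤
  · subst htop
    exact ⟨⊤, le_top, by rw [relIndex_top_left]; exact isPiNumber_one,
      by rw [index_top]; exact isPiNumber_one⟩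
  obtain ⟨L, hL, hlt, hstep⟩ := hG N hN htop
  have hHL : IsPiNumber πᶜ (L.relIndex (H ⊔ L)) := by
    rw [relIndex_sup_right]
    exact hH.of_dvd (relIndex_dvd_of_le_left _ hlt.le)
  obtain ⟨V, hHV, hLV, hV⟩ := ih L hlt hL (H ⊔ L) le_sup_right hHL
  have hLV' : L ≤ V := le_sup_right.trans hHV
  have hHV' : H ≤ V := le_sup_left.trans hHV
  -- If `L / N` is a `π'`-group, `V` itself works. Otherwise `L / N` is a normal abelian Hall
  -- subgroup of `V / N`, and a complement containing `H / N` is pulled back.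
  rcases hstep with h | ⟨h, hcomm⟩
  · refine ⟨V, hHV', ?_, hV⟩
    rw [← relIndex_mul_relIndex N L V hlt.le hLV']
    exact h.mul hLV
  · have hs := QuotientGroup.mk'_surjective N
    have hker : (QuotientGroup.mk' N).ker = N := QuotientGroup.ker_mk' N
    have hcard (X : Subgroup G) : Nat.card (X.map (QuotientGroup.mk' N)) = N.relIndex X := by
      rw [← relIndex_ker, hker]
    have hrel : (L.map (QuotientGroup.mk' N)).relIndex (V.map (QuotientGroup.mk' N)) =
        L.relIndex V := by
      rw [relIndex_map_map, hker, sup_eq_left.2 hlt.le, sup_eq_left.2 (hlt.le.trans hLV')]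
    have : (L.map (QuotientGroup.mk' N)).Normal := hL.map _ hs
    obtain ⟨C, hHC, hCV, hC, hCi⟩ := exists_relative_complement_ge (L.map (QuotientGroup.mk' N))
      (V.map (QuotientGroup.mk' N)) (H.map (QuotientGroup.mk' N)) (map_mono hLV') (map_mono hHV')
      (by
        rintro _ ⟨x, hx, rfl⟩ _ ⟨y, hy, rfl⟩
        rw [← commutatorElement_eq_one_iff_mul_comm, ← map_commutatorElement]
        exact (QuotientGroup.eq_one_iff _).2 (hcomm x hx y hy))
      (by rw [hcard, hrel]; exact h.coprime hLV) (by rw [hcard, hcard]; exact h.coprime hH)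
    refine ⟨C.comap (QuotientGroup.mk' N), map_le_iff_le_comap.1 hHC, ?_, ?_⟩
    · rw [← hcard, map_comap_eq_self_of_surjective hs, hC, hrel]
      exact hLV
    · rw [index_comap_of_surjective _ hs, ← relIndex_mul_index hCV, hCi, hcard,
        index_map_eq _ hs (by rw [hker]; exact hlt.le.trans hLV')]
      exact h.mul hV

/-! ### The `π`-core and normal Hall subgroups -/

section Core

variable {G : Type*} [Group G] {π : Set Nat.Primes}

theorem le_piCore {N : Subgroup G} (hN : N.Normal) (h : IsPiNumber π (Nat.card N)) :
    N ≤ piCore π G :=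
  le_sSup ⟨hN, h⟩

theorem piCore_spec (π : Set Nat.Primes) (G : Type*) [Group G] [Finite G] :
    (piCore π G).Normal ∧ IsPiNumber π (Nat.card (piCore π G)) := by
  obtain ⟨N, hN⟩ := exists_maximal_of_wellFoundedGT
    (fun N : Subgroup G => N.Normal ∧ IsPiNumber π (Nat.card N))
    ⟨⊥, inferInstance, by rw [card_bot]; exact isPiNumber_one⟩
  have hNn := hN.prop.1
  have heq : piCore π G = N := by
    refine le_antisymm (sSup_le fun M ⟨hM, hM'⟩ => ?_) (le_piCore hNn hN.prop.2)
    refine le_sup_right.trans (hN.le_of_ge (y := N ⊔ M) ⟨inferInstance, ?_⟩ le_sup_left)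
    rw [← card_mul_relIndex (le_sup_left : N ≤ N ⊔ M), relIndex_sup_left]
    exact hN.prop.2.mul (IsPiNumber.of_dvd hM' (relIndex_dvd_card _ _))
  rw [heq]
  exact hN.prop

instance piCore_normal [Finite G] : (piCore π G).Normal :=
  (piCore_spec π G).1

theorem isPiNumber_card_piCore [Finite G] : IsPiNumber π (Nat.card (piCore π G)) :=
  (piCore_spec π G).2

theorem map_equiv_piCore_le {H : Type*} [Group H] [Finite G] (e : G ≃* H) :
    (piCore π G).map (e : G →* H) ≤ piCore π H := by
  refine le_piCore (piCore_normal.map _ e.surjective) ?_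
  rw [card_map_of_injective (f := (e : G →* H)) e.injective]
  exact isPiNumber_card_piCore

instance piCore_characteristic [Finite G] : (piCore π G).Characteristic :=
  characteristic_iff_map_le.2 fun φ => map_equiv_piCore_le φ

theorem map_piCore_le {H : Type*} [Group H] [Finite G] [Finite H] (f : H →* G)
    (hf : Function.Injective f) [f.range.Normal] : (piCore π H).map f ≤ piCore π G := by
  have h₁ := map_equiv_piCore_le (π := π) (f.ofInjective hf)
  have h₂ : (piCore π f.range).map f.range.subtype ≤ piCore π G := by
    refine le_piCore inferInstance ?_
    rw [card_map_of_injective f.range.subtype_injective]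
    exact isPiNumber_card_piCore
  refine le_trans ?_ h₂
  rintro _ ⟨x, hx, rfl⟩
  exact ⟨f.ofInjective hf x, h₁ ⟨x, hx, rfl⟩, rfl⟩

/-- The index `|U : U ∩ N|` divides both `|U|` and `|G : N|`, so it is a `π`-number and a
`π'`-number, hence 1. -/
theorem le_of_isHall {N U : Subgroup G} [N.Normal] (hN : IsHall π N)
    (hU : IsPiNumber π (Nat.card U)) : U ≤ N :=
  relIndex_eq_one.1 <| (hU.of_dvd (relIndex_dvd_card N U)).eq_one
    (IsPiNumber.of_dvd (π := πᶜ) hN.2 (relIndex_dvd_index_of_normal N U))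

theorem characteristic_of_isHall {N : Subgroup G} [N.Normal] (hN : IsHall π N) :
    N.Characteristic :=
  characteristic_iff_map_le.2 fun φ => le_of_isHall hN <| by
    rw [card_map_of_injective (f := φ.toMonoidHom) φ.injective]
    exact hN.1

theorem isHall_piCore_of_isPiClosed [Finite G] (h : IsPiClosed π G) : IsHall π (piCore π G) := by
  obtain ⟨N, hN, hN'⟩ := h
  rwa [le_antisymm (le_of_isHall hN' isPiNumber_card_piCore) (le_piCore hN hN'.1)]

theorem IsPiClosed.of_equiv {H : Type*} [Group H] (e : G ≃* H) (h : IsPiClosed π G) :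
    IsPiClosed π H := by
  obtain ⟨N, hN, h₁, h₂⟩ := h
  refine ⟨N.map (e : G →* H), hN.map _ e.surjective, ?_, ?_⟩
  · change IsPiNumber π (Nat.card _)
    rw [card_map_of_injective (f := (e : G →* H)) e.injective]
    exact h₁
  · rw [index_map_equiv]
    exact h₂

theorem isPiClosed_of_normal_le {N W : Subgroup G} [N.Normal] (hNW : N ≤ W)
    (hN : IsPiNumber π (Nat.card N)) (hW : IsPiNumber πᶜ (N.relIndex W)) : IsPiClosed π W := by
  refine ⟨N.subgroupOf W, inferInstance, ?_, hW⟩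
  change IsPiNumber π (Nat.card _)
  rwa [Nat.card_congr (subgroupOfEquivOfLe hNW).toEquiv]

end Core

/-! ### The Hall–Higman argument and the radical -/

section HallHigman

variable {G : Type*} [Group G] [Finite G] {π : Set Nat.Primes}

theorem HasPiSteps.centralizer_piCore_compl_le (hG : HasPiSteps π G) (hcore : piCore π G = ⊥) :
    centralizer (piCore πᶜ G : Set G) ≤ piCore πᶜ G := by
  set K := piCore πᶜ G with hK
  have hKcard : IsPiNumber πᶜ (Nat.card K) := isPiNumber_card_piCore
  by_contra hnot
  obtain ⟨L, hL, hlt, hLC, hstep⟩ := hG.exists_le (MonoidHom.id G) Function.injective_id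
    (centralizer (K : Set G) ⊓ K) (centralizer (K : Set G))
    (lt_of_le_of_ne inf_le_left fun h => hnot (inf_eq_left.1 h))
  set A := centralizer (K : Set G) ⊓ K with hA
  have hAcard : IsPiNumber πᶜ (Nat.card A) := hKcard.of_dvd (card_dvd_of_le inf_le_right)
  rcases hstep with h | ⟨h, -⟩
  · refine hlt.not_ge (le_inf hLC (le_piCore hL ?_))
    rw [← card_mul_relIndex hlt.le]
    exact hAcard.mul h
  · have hcA : Nat.card (A.subgroupOf L) = Nat.card A :=
      Nat.card_congr (subgroupOfEquivOfLe hlt.le).toEquiv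
    obtain ⟨S, hS⟩ := exists_right_complement'_of_coprime (N := A.subgroupOf L)
      (by rw [hcA]; exact (h.coprime hAcard).symm)
    -- `S` centralizes `A`, since `L ≤ C(K)` and `A ≤ K`. So `S` is normal in `L`, hence
    -- characteristic as a Hall subgroup, and lies in `O_π(G) = 1`.
    have hScard : Nat.card S = A.relIndex L := hS.symm.index_eq_card.symm
    have hSn : S.Normal := by
      rw [← normalizer_eq_top_iff, eq_top_iff, ← hS.sup_eq_top]
      refine sup_le (fun a ha => ?_) le_normalizer
      refine centralizer_le_normalizer (S : Set L) (mem_centralizer_iff.2 fun s _ => ?_)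
      exact Subtype.ext (mem_centralizer_iff.1 (hLC s.2) a ha.2).symm
    have hSH : IsHall π S := by
      refine ⟨?_, ?_⟩
      · change IsPiNumber π (Nat.card S)
        rwa [hScard]
      · change IsPiNumber πᶜ S.index
        rwa [hS.index_eq_card, hcA]
    have := characteristic_of_isHall hSH
    have hbot : S.map L.subtype ≤ piCore π G := by
      refine le_piCore inferInstance ?_
      rw [card_map_of_injective L.subtype_injective]
      exact hSH.1
    rw [hcore, le_bot_iff, map_eq_bot_iff_of_injective _ L.subtype_injective] at hbot
    rw [hbot, card_bot] at hScard
    exact hlt.not_ge (relIndex_eq_one.1 hScard.symm)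

/-- `N` and `O_{π'}(G)` normalize each other and have coprime orders, so they commute; then `N ≤
C(O_{π'}(G)) ≤ O_{π'}(G)`. -/
theorem HasPiSteps.eq_bot_of_normalized (hG : HasPiSteps π G) (hcore : piCore π G = ⊥)
    {N : Subgroup G} (hN : IsPiNumber π (Nat.card N))
    (hnorm : ∀ k ∈ piCore πᶜ G, ∀ n ∈ N, k * n * k⁻¹ ∈ N) : N = ⊥ := by
  have hinf : N ⊓ piCore πᶜ G = ⊥ :=
    (disjoint_of_coprime_natCard (hN.coprime isPiNumber_card_piCore)).eq_bot
  have hle : N ≤ piCore πᶜ G := by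
    refine le_trans (fun n hn => mem_centralizer_iff.2 fun k hk => ?_)
      (hG.centralizer_piCore_compl_le hcore)
    have hmem : ⁅k, n⁆ ∈ N ⊓ piCore πᶜ G := by
      refine mem_inf.2 ⟨mul_mem (hnorm k hk n hn) (inv_mem hn), ?_⟩
      rw [commutatorElement_def, mul_assoc, mul_assoc, ← mul_assoc n]
      exact mul_mem hk (piCore_normal.conj_mem _ (inv_mem hk) n)
    rw [hinf, mem_bot] at hmem
    exact commutatorElement_eq_one_iff_mul_comm.1 hmem
  rwa [inf_eq_left.2 hle] at hinf

theorem piCore_quotient_piCore : piCore π (G ⧸ piCore π G) = ⊥ := by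
  have hs := QuotientGroup.mk'_surjective (piCore π G)
  have hle : piCore π G ≤ (piCore π (G ⧸ piCore π G)).comap (QuotientGroup.mk' (piCore π G)) := by
    simpa using MonoidHom.ker_le_comap (QuotientGroup.mk' (piCore π G)) (piCore π (G ⧸ piCore π G))
  have h : (piCore π (G ⧸ piCore π G)).comap (QuotientGroup.mk' (piCore π G)) ≤ piCore π G := by
    refine le_piCore inferInstance ?_
    have hr := relIndex_ker (QuotientGroup.mk' (piCore π G))
      (K := (piCore π (G ⧸ piCore π G)).comap (QuotientGroup.mk' (piCore π G)))
    rw [QuotientGroup.ker_mk', map_comap_eq_self_of_surjective hs] at hr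
    rw [← card_mul_relIndex hle, hr]
    exact isPiNumber_card_piCore.mul isPiNumber_card_piCore
  rw [← map_comap_eq_self_of_surjective hs (piCore π (G ⧸ piCore π G)), Subgroup.map_eq_bot_iff,
    QuotientGroup.ker_mk']
  exact h

/-- The `π`-closed radical of a finite group is `O_{π,π'}(G)`. -/
theorem radical_eq_comap : radical (piClosedSubgroups π G) =
    (piCore πᶜ (G ⧸ piCore π G)).comap (QuotientGroup.mk' (piCore π G)) := by
  have hs := QuotientGroup.mk'_surjective (piCore π G)
  have hr (X : Subgroup G) : (piCore π G).relIndex X =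
      Nat.card (X.map (QuotientGroup.mk' (piCore π G))) := by
    rw [← relIndex_ker, QuotientGroup.ker_mk']
  apply le_antisymm
  · refine sSup_le fun M ⟨hM, hMc⟩ => ?_
    -- As `O_π(M) ≤ O_π(G)`, the image of `M` modulo `O_π(G)` is a quotient of the `π'`-group `M /
    -- O_π(M)`.
    have hle : (piCore π M).map M.subtype ≤ piCore π G := by
      have : M.subtype.range.Normal := by rwa [range_subtype]
      exact map_piCore_le M.subtype M.subtype_injective
    rw [← map_le_iff_le_comap]
    refine le_piCore (hM.map _ hs) ?_
    rw [← hr]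
    refine IsPiNumber.of_dvd (isHall_piCore_of_isPiClosed hMc).2 ?_
    rw [show (piCore π M).index = ((piCore π M).map M.subtype).relIndex M by
      rw [relIndex, subgroupOf, comap_map_eq_self_of_injective M.subtype_injective]]
    exact relIndex_dvd_of_le_left _ hle
  · refine le_sSup ⟨inferInstance, isPiClosed_of_normal_le (N := piCore π G) ?_
      isPiNumber_card_piCore ?_⟩
    · simpa using MonoidHom.ker_le_comap (QuotientGroup.mk' (piCore π G))
        (piCore πᶜ (G ⧸ piCore π G))
    · rw [hr, map_comap_eq_self_of_surjective hs]
      exact isPiNumber_card_piCore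

theorem piCore_le_radical : piCore π G ≤ radical (piClosedSubgroups π G) := by
  rw [radical_eq_comap]
  simpa using MonoidHom.ker_le_comap (QuotientGroup.mk' (piCore π G)) (piCore πᶜ (G ⧸ piCore π G))

theorem isPiNumber_relIndex_radical :
    IsPiNumber πᶜ ((piCore π G).relIndex (radical (piClosedSubgroups π G))) := by
  have hr := relIndex_ker (QuotientGroup.mk' (piCore π G))
    (K := radical (piClosedSubgroups π G))
  rw [QuotientGroup.ker_mk', radical_eq_comap,
    map_comap_eq_self_of_surjective (QuotientGroup.mk'_surjective _)] at hr
  rw [radical_eq_comap, hr]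
  exact isPiNumber_card_piCore

instance radical_normal : (radical (piClosedSubgroups π G)).Normal := by
  rw [radical_eq_comap]
  infer_instance

theorem radical_mem_piClosedSubgroups :
    radical (piClosedSubgroups π G) ∈ piClosedSubgroups π G :=
  isPiClosed_of_normal_le piCore_le_radical isPiNumber_card_piCore isPiNumber_relIndex_radical

/-- The normal Hall `π`-subgroup of a `π`-closed subgroup containing the radical is `O_π(G)`. -/
theorem HasPiSteps.isPiNumber_relIndex_of_radical_le (hG : HasPiSteps π G) {W : Subgroup G}
    (hW : IsPiClosed π W) (hle : radical (piClosedSubgroups π G) ≤ W) :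
    IsPiNumber πᶜ ((piCore π G).relIndex W) := by
  have hs := QuotientGroup.mk'_surjective (piCore π G)
  obtain ⟨N, hN, h₁, h₂⟩ := hW
  have hbot : (N.map W.subtype).map (QuotientGroup.mk' (piCore π G)) = ⊥ := by
    refine (hG.quotient (piCore π G)).eq_bot_of_normalized piCore_quotient_piCore ?_ ?_
    · refine IsPiNumber.of_dvd h₁ ((card_map_dvd _ _).trans ?_)
      rw [card_map_of_injective W.subtype_injective]
    · rintro k hk _ ⟨_, ⟨n, hn, rfl⟩, rfl⟩
      obtain ⟨w, rfl⟩ := hs k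
      have hw : w ∈ W := hle (by rw [radical_eq_comap]; exact hk)
      exact ⟨_, ⟨_, hN.conj_mem n hn ⟨w, hw⟩, rfl⟩, rfl⟩
  rw [Subgroup.map_eq_bot_iff, QuotientGroup.ker_mk'] at hbot
  refine IsPiNumber.of_dvd h₂ ?_
  rw [show N.index = (N.map W.subtype).relIndex W by
    rw [relIndex, subgroupOf, comap_map_eq_self_of_injective W.subtype_injective]]
  exact relIndex_dvd_of_le_left _ hbot

end HallHigman

/-! ### Hall subgroups over the core and injectors -/

/-- `V` contains `O_π(G)`, and `V / O_π(G)` is a Hall `π'`-subgroup of `G / O_π(G)`. -/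
structure IsHallOverCore {G : Type*} [Group G] (π : Set Nat.Primes) (V : Subgroup G) : Prop where
  core_le : piCore π G ≤ V
  relIndex_core : IsPiNumber πᶜ ((piCore π G).relIndex V)
  index : IsPiNumber π V.index

theorem IsInjector.isMaximalIn_top {G : Type*} [Group G] {π : Set Nat.Primes} {V : Subgroup G}
    (hV : IsInjector (piClosedSubgroups π G) V) :
    IsMaximalIn (piClosedSubgroups π G) ⊤ V := by
  simpa using hV ⊤ IsSubnormal.top

section HallOverCore

variable {G : Type*} [Group G] [Finite G] {π : Set Nat.Primes} {V : Subgroup G}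

theorem IsHallOverCore.isPiClosed (hV : IsHallOverCore π V) : IsPiClosed π V :=
  isPiClosed_of_normal_le hV.core_le isPiNumber_card_piCore hV.relIndex_core

/-- For the radical `R`, `|R : V ∩ R|` divides `|G : V|`, a `π`-number, and `|R : O_π(G)|`, a
`π'`-number. -/
theorem IsHallOverCore.radical_le (hV : IsHallOverCore π V) :
    radical (piClosedSubgroups π G) ≤ V :=
  relIndex_eq_one.1 <| (hV.index.of_dvd (relIndex_dvd_index_of_normal_right _ _)).eq_one <|
    isPiNumber_relIndex_radical.of_dvd (relIndex_dvd_of_le_left _ hV.core_le)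

theorem IsHallOverCore.ge_of_isPiClosed (hG : HasPiSteps π G) (hV : IsHallOverCore π V) {W : Subgroup G}
    (hW : IsPiClosed π W) (hVW : V ≤ W) : W ≤ V :=
  relIndex_eq_one.1 <| (hV.index.of_dvd (relIndex_dvd_index_of_le hVW)).eq_one <|
    (hG.isPiNumber_relIndex_of_radical_le hW (hV.radical_le.trans hVW)).of_dvd
      (relIndex_dvd_of_le_left _ hV.core_le)

theorem HasPiSteps.isHallOverCore_of_maximal (hG : HasPiSteps π G)
    (hV : IsMaximalIn (piClosedSubgroups π G) ⊤ V) (hle : radical (piClosedSubgroups π G) ≤ V) :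
    IsHallOverCore π V := by
  have hcore := piCore_le_radical.trans hle
  obtain ⟨W, hVW, h₁, h₂⟩ := hG.exists_hall_ge (piCore π G) piCore_normal V hcore
    (hG.isPiNumber_relIndex_of_radical_le hV.prop.1 hle)
  have hW : IsHallOverCore π W := ⟨hcore.trans hVW, h₁, h₂⟩
  rwa [le_antisymm hVW (hV.le_of_ge ⟨hW.isPiClosed, le_top⟩ hVW)]

theorem isHallOverCore_iff_exists_hall :
    IsHallOverCore π V ↔
      ∃ P : Subgroup G, IsHall πᶜ P ∧ (V : Set G) = (P : Set G) * (piCore π G : Set G) := by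
  constructor
  · intro hV
    have hcard : Nat.card ((piCore π G).subgroupOf V) = Nat.card (piCore π G) :=
      Nat.card_congr (subgroupOfEquivOfLe hV.core_le).toEquiv
    obtain ⟨S, hS⟩ := exists_right_complement'_of_coprime (N := (piCore π G).subgroupOf V)
      (by rw [hcard]; exact isPiNumber_card_piCore.coprime hV.relIndex_core)
    refine ⟨S.map V.subtype, ⟨?_, ?_⟩, ?_⟩
    · change IsPiNumber πᶜ (Nat.card _)
      rw [card_map_of_injective V.subtype_injective, ← hS.symm.index_eq_card]
      exact hV.relIndex_core
    · change IsPiNumber πᶜᶜ _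
      rw [compl_compl, index_map_subtype, hS.index_eq_card, hcard]
      exact isPiNumber_card_piCore.mul hV.index
    · rw [← mul_normal]
      have h := congrArg (Subgroup.map V.subtype) hS.sup_eq_top
      rw [Subgroup.map_sup, map_subgroupOf_eq_of_le hV.core_le, ← MonoidHom.range_eq_map,
        range_subtype] at h
      rw [sup_comm, h]
  · rintro ⟨P, ⟨h₁, h₂⟩, hV⟩
    rw [← mul_normal, SetLike.coe_set_eq] at hV
    subst hV
    refine ⟨le_sup_right, ?_, ?_⟩
    · rw [relIndex_sup_right]
      exact IsPiNumber.of_dvd h₁ (relIndex_dvd_card _ _)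
    · have h₂ : IsPiNumber πᶜᶜ P.index := h₂
      rw [compl_compl] at h₂
      exact h₂.of_dvd (index_dvd_of_le le_sup_left)

/-- Injective maps with normal range cover each inclusion in a subnormal chain, where the ambient
group changes. -/
theorem IsHallOverCore.comap {H : Type*} [Group H] [Finite H] (hV : IsHallOverCore π V)
    (f : H →* G) (hf : Function.Injective f) [f.range.Normal] :
    IsHallOverCore π (V.comap f) := by
  refine ⟨map_le_iff_le_comap.1 ((map_piCore_le f hf).trans hV.core_le), ?_, ?_⟩
  · have hle : (piCore π G).comap f ≤ piCore π H := by
      refine le_piCore inferInstance ((isPiNumber_card_piCore (G := G)).of_dvd ?_)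
      exact card_comap_dvd_of_injective _ f hf
    refine hV.relIndex_core.of_dvd ((relIndex_dvd_of_le_left _ hle).trans ?_)
    rw [relIndex_comap]
    exact relIndex_dvd_of_le_right _ (map_comap_le f V)
  · rw [index_comap]
    exact hV.index.of_dvd (relIndex_dvd_index_of_normal_right _ _)

theorem IsHallOverCore.subgroupOf_of_isSubnormal (hV : IsHallOverCore π V) {K : Subgroup G}
    (hK : K.IsSubnormal) : IsHallOverCore π (V.subgroupOf K) := by
  induction hK with
  | top =>
    have : (⊤ : Subgroup G).subtype.range.Normal := by rw [range_subtype]; infer_instance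
    exact hV.comap _ (subtype_injective _)
  | step H K hle hK hN ih =>
    have : (inclusion hle).range.Normal := by rwa [inclusion_range]
    exact ih.comap (inclusion hle) (inclusion_injective hle)

theorem IsHallOverCore.isInjector (hG : HasPiSteps π G) (hV : IsHallOverCore π V) :
    IsInjector (piClosedSubgroups π G) V := by
  intro K hK
  have h := hV.subgroupOf_of_isSubnormal hK
  refine ⟨⟨?_, inf_le_right⟩, fun W ⟨hW, hWK⟩ hle => ?_⟩
  · have hc := h.isPiClosed
    rw [← inf_subgroupOf_right] at hc
    exact hc.of_equiv (subgroupOfEquivOfLe inf_le_right)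
  · have hle' : W.subgroupOf K ≤ V.subgroupOf K := by
      refine h.ge_of_isPiClosed (hG.subgroup K) (IsPiClosed.of_equiv (subgroupOfEquivOfLe hWK).symm hW) ?_
      rw [← inf_subgroupOf_right]
      exact comap_mono hle
    exact fun w hw => mem_inf.2 ⟨hle' (x := ⟨w, hWK hw⟩) hw, hWK hw⟩

/-- The radical is normal and itself `π`-closed, so maximality of `V ∩ K` for `K` the radical gives
`V ∩ K = K`. -/
theorem IsInjector.radical_le (hV : IsInjector (piClosedSubgroups π G) V) :
    radical (piClosedSubgroups π G) ≤ V :=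
  ((hV _ radical_normal.isSubnormal).le_of_ge ⟨radical_mem_piClosedSubgroups, le_rfl⟩
    inf_le_right).trans inf_le_left

theorem HasPiSteps.isInjector_iff (hG : HasPiSteps π G) :
    IsInjector (piClosedSubgroups π G) V ↔ IsHallOverCore π V :=
  ⟨fun h => hG.isHallOverCore_of_maximal h.isMaximalIn_top h.radical_le, fun h => h.isInjector hG⟩

end HallOverCore

end PiClosedInjectors

open PiClosedInjectors in
open scoped Pointwise in
theorem corollary6p1 {G : Type*} [Group G] [Finite G] (π : Set Nat.Primes)
    (hG : IsPiSoluble π G) (V : Subgroup G) :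
    (IsInjector (piClosedSubgroups π G) V ↔
      ∃ P : Subgroup G, IsHall πᶜ P ∧ (V : Set G) = (P : Set G) * (piCore π G : Set G)) ∧
    (IsInjector (piClosedSubgroups π G) V ↔
      IsMaximalIn (piClosedSubgroups π G) ⊤ V ∧ radical (piClosedSubgroups π G) ≤ V) :=
  ⟨hG.hasPiSteps.isInjector_iff.trans isHallOverCore_iff_exists_hall,
    fun h => ⟨h.isMaximalIn_top, h.radical_le⟩,
    fun h => (hG.hasPiSteps.isHallOverCore_of_maximal h.1 h.2).isInjector hG.hasPiSteps⟩
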